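/- \textbf{Theorem (Small bodies).} Let $j:\mathbb R^3\to[0,+\infty]$ be a Borel measurable function such that (J1) $j(-z)=j(z)$ for all $z\in\mathbb R^3$; (J2) $\int_{\mathbb R^3}\min\{1,|z|^2\}\,j(z)\,dz<+\infty$; (J5) there are $R_0>0$, $C>0$ and $s\in(0,1)$ with $j(z)\ge C\,|z|^{-3-2s}$ whenever $0<|z|<R_0$. For $R>0$ let $B_R\subset\mathbb R^3$ be the open ball of radius $R$ centered at the origin. For $m\in L^2(B_R;\mathbb R^3)$ put $$\mathcal J_{B_R}(m)=\iint_{B_R\times B_R} j(x-y)\,|m(x)-m(y)|^2\,dx\,dy,\qquad \mathcal W_{B_R}(m)=-\int_{B_R}h_d[m]\cdot m\,dx,$$ where $h_d[m]$ is the unique field in $L^2(\mathbb R^3;\mathbb R^3)$ that solves, in the sense of distributions, $\operatorname{div}(m\chi_{B_R}+h_d[m])=0$ and $\operatorname{curl}h_d[m]=0$ in $\mathbb R^3$ ($m\chi_{B_R}$ is the extension of $m$ by zero). Let $$\mathcal X^j(B_R;\mathbb S^2)=\{m\in L^2(B_R;\mathbb R^3): |m|=1 \text{ a.e. in } B_R,\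 \mathcal J_{B_R}(m)<+\infty\},$$ and $\mathcal E_{B_R}=\mathcal J_{B_R}+\mathcal W_{B_R}$ on $\mathcal X^j(B_R;\mathbb S^2)$. Then for every such $j$ and every $R_0,C,s$ as in (J5) there is a critical radius $R^*\in(0,R_0/2)$ such that, for every $0<R\le R^*$, every minimizer of $\mathcal E_{B_R}$ in $\mathcal X^j(B_R;\mathbb S^2)$ is constant (almost everywhere in $B_R$). -/

import Mathlib

open MeasureTheory
open scoped ENNReal ContDiff

namespace NonlocalMicromagnetics

noncomputable section

/-- Euclidean three-space. -/
abbrev R3 : Type := EuclideanSpace ℝ (Fin 3)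

/-- Symmetry of the kernel: `j (-z) = j z` for all `z`. -/
def KernelSymmetric (j : R3 → ℝ≥0∞) : Prop :=
  ∀ z, j (-z) = j z

/-- Lévy-type condition: the integral of `min {1, |z|²} j(z)` over the whole space is finite. -/
def KernelLevy (j : R3 → ℝ≥0∞) : Prop :=
  ∫⁻ z, ENNReal.ofReal (min 1 (‖z‖ ^ 2)) * j z < ⊤

/-- Fractional lower bound `j(z) ≥ C |z|^(-3-2s)` on the punctured ball of radius `R₀`, with
`R₀ > 0`, `C > 0` and `s ∈ (0,1)`.  (No condition is put on the single value `j 0`.) -/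
def KernelLowerBound (j : R3 → ℝ≥0∞) (R₀ C s : ℝ) : Prop :=
  0 < R₀ ∧ 0 < C ∧ 0 < s ∧ s < 1 ∧
    ∀ z : R3, z ≠ 0 → ‖z‖ < R₀ → ENNReal.ofReal (C / ‖z‖ ^ (3 + 2 * s)) ≤ j z

/-- The nonlocal exchange energy: the double integral over `Ω × Ω` of `j(x - y) |m(x) - m(y)|²`,
with values in `[0, ∞]`. -/
def exchangeEnergy (j : R3 → ℝ≥0∞) (Ω : Set R3) (m : R3 → R3) : ℝ≥0∞ :=
  ∫⁻ x in Ω, ∫⁻ y in Ω, j (x - y) * ENNReal.ofReal (‖m x - m y‖ ^ 2)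

/-- `div v = 0` on the whole space in the sense of distributions. -/
def WeakDivFree (v : R3 → R3) : Prop :=
  ∀ φ : R3 → ℝ, ContDiff ℝ ∞ φ → HasCompactSupport φ →
    ∫ x, inner ℝ (v x) (gradient φ x) = 0

/-- The `i`-th partial derivative of a scalar function. -/
def partialDeriv (i : Fin 3) (φ : R3 → ℝ) (x : R3) : ℝ :=
  fderiv ℝ φ x (EuclideanSpace.single i 1)

/-- `curl v = 0` on the whole space in the sense of distributions: `∂ᵢ vₖ = ∂ₖ vᵢ` for all
`i`, `k`, tested against smooth compactly supported functions. -/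
def WeakCurlFree (v : R3 → R3) : Prop :=
  ∀ φ : R3 → ℝ, ContDiff ℝ ∞ φ → HasCompactSupport φ → ∀ i k : Fin 3,
    ∫ x, v x k * partialDeriv i φ x = ∫ x, v x i * partialDeriv k φ x

/-- `h` is an `L²(ℝ³; ℝ³)` solution of the magnetostatic Maxwell equations
`div (m χ_Ω + h) = 0`, `curl h = 0` in `ℝ³`. -/
structure IsDemagField (Ω : Set R3) (m h : R3 → R3) : Prop where
  memLp : MemLp h 2 volume
  div_eq : WeakDivFree (fun x => Ω.indicator m x + h x)
  curl_eq : WeakCurlFree h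

open Classical in
/-- The demagnetizing field `h_d[m]`: the solution in `L²(ℝ³; ℝ³)` of the magnetostatic Maxwell
equations.  For `m ∈ L²(Ω; ℝ³)` it exists and is unique almost everywhere; the default value `0`
is used only for those `m` for which there is no solution. -/
def demagField (Ω : Set R3) (m : R3 → R3) : R3 → R3 :=
  if hex : ∃ h, IsDemagField Ω m h then hex.choose else 0

/-- The magnetostatic self-energy `- ∫_Ω h_d[m] · m`. -/
def magnetostaticEnergy (Ω : Set R3) (m : R3 → R3) : ℝ :=
  - ∫ x in Ω, inner ℝ (demagField Ω m x) (m x)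

/-- The micromagnetic energy, exchange plus magnetostatic self-energy. -/
def energy (j : R3 → ℝ≥0∞) (Ω : Set R3) (m : R3 → R3) : EReal :=
  (exchangeEnergy j Ω m : EReal) + (magnetostaticEnergy Ω m : EReal)

/-- The admissible class: `m ∈ L²(Ω; ℝ³)`, `m ∈ 𝕊²` almost everywhere in `Ω`, with finite
exchange energy.  Elements are represented by functions on `ℝ³`, of which only the almost
everywhere class on `Ω` matters. -/
structure Admissible (j : R3 → ℝ≥0∞) (Ω : Set R3) (m : R3 → R3) : Prop where
  memLp : MemLp m 2 (volume.restrict Ω)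
  unit : ∀ᵐ x ∂(volume.restrict Ω), m x ∈ Metric.sphere (0 : R3) 1
  finite : exchangeEnergy j Ω m < ⊤

/-- `m` minimizes the micromagnetic energy in the admissible class. -/
def IsMinimizer (j : R3 → ℝ≥0∞) (Ω : Set R3) (m : R3 → R3) : Prop :=
  Admissible j Ω m ∧ ∀ u, Admissible j Ω u → energy j Ω m ≤ energy j Ω u

/-- `m` is (almost everywhere equal to) a constant on `Ω`. -/
def IsConstantOn (Ω : Set R3) (m : R3 → R3) : Prop :=
  ∃ σ : R3, ∀ᵐ x ∂(volume.restrict Ω), m x = σ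

end

end NonlocalMicromagnetics

/-! Let `V` be the volume of the ball and `M` the integral of `m`. Any two points of the ball are
closer than `2R < R₀`, so the kernel is at least `κ = C / (2R)^(3+2s)` there. Since `|m| = 1`, the
exchange energy is therefore at least `2κ(V² - |M|²)`. The magnetostatic energy is the squared `L²`
norm of the demagnetizing field, a convex quadratic form; comparison with the uniform magnetization
`M/V`, whose field inside the ball is `-M/(3V)`, bounds it below by `|M|²/(3V)`. A constant unit
field has energy exactly `V/3`. For a minimizer this gives `6κV(V² - |M|²) ≤ V² - |M|²`. Because
`6κV = πC/(2R)^(2s)` exceeds 1 for small `R`, it follows that `|M| = V`, which forces `m` to be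
constant (`isConstantOn_of_isMinimizer`, `one_lt_of_radius_le`).

The magnetostatic part (`le_magnetostaticEnergy`, `magnetostaticEnergy_const`) needs existence and
uniqueness of the field and the orthogonality of divergence-free and curl-free `L²` fields. These
come from projection onto the closure of the test gradients and a Liouville theorem for `L²`
harmonic functions, proved with smooth radial averages. The field of the uniform ball is computed
explicitly from its Newtonian potential. -/

open Filter Topology

namespace NonlocalMicromagnetics

/-! ### Radial test functions and their Laplacians -/

/-- The primitive of `expNegInvGlue` that vanishes on the negative half-line. -/
noncomputable def glue (t : ℝ) : ℝ := ∫ s in (0 : ℝ)..t, expNegInvGlue s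

theorem continuous_expNegInvGlue : Continuous expNegInvGlue :=
  (expNegInvGlue.contDiff (n := 0)).continuous

theorem hasDerivAt_glue (t : ℝ) : HasDerivAt glue (expNegInvGlue t) t :=
  intervalIntegral.integral_hasDerivAt_right
    (continuous_expNegInvGlue.intervalIntegrable _ _)
    (continuous_expNegInvGlue.stronglyMeasurableAtFilter _ _)
    continuous_expNegInvGlue.continuousAt

theorem contDiff_glue : ContDiff ℝ ∞ glue := by
  rw [contDiff_infty_iff_deriv]
  refine ⟨fun t => (hasDerivAt_glue t).differentiableAt, ?_⟩
  rw [show deriv glue = expNegInvGlue from funext fun t => (hasDerivAt_glue t).deriv]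
  exact expNegInvGlue.contDiff

theorem glue_of_nonpos {t : ℝ} (ht : t ≤ 0) : glue t = 0 := by
  unfold glue
  rw [intervalIntegral.integral_congr (g := fun _ => 0)]
  · simp
  · intro s hs
    rw [Set.uIcc_of_ge ht] at hs
    exact expNegInvGlue.zero_of_nonpos hs.2

theorem hasDerivAt_expNegInvGlue (t : ℝ) :
    HasDerivAt expNegInvGlue (deriv expNegInvGlue t) t :=
  ((expNegInvGlue.contDiff (n := 1)).differentiable one_ne_zero t).hasDerivAt

theorem continuous_deriv_expNegInvGlue : Continuous (deriv expNegInvGlue) :=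
  (expNegInvGlue.contDiff (n := 1)).continuous_deriv le_rfl

theorem deriv_expNegInvGlue_of_neg {t : ℝ} (ht : t < 0) : deriv expNegInvGlue t = 0 := by
  have h : expNegInvGlue =ᶠ[𝓝 t] fun _ => 0 := by
    filter_upwards [Iio_mem_nhds ht] with s hs using expNegInvGlue.zero_of_nonpos (le_of_lt hs)
  rw [h.deriv_eq, deriv_const]

theorem expNegInvGlue_le_one (t : ℝ) : expNegInvGlue t ≤ 1 := by
  unfold expNegInvGlue
  split_ifs with h
  · exact zero_le_one
  · rw [Real.exp_le_one_iff, neg_nonpos]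
    exact inv_nonneg.2 (le_of_lt (not_le.1 h))

theorem partialDeriv_eq {i : Fin 3} {φ : R3 → ℝ} {L : R3 →L[ℝ] ℝ} {x : R3}
    (h : HasFDerivAt φ L x) : partialDeriv i φ x = L (EuclideanSpace.single i 1) := by
  rw [partialDeriv, h.fderiv]

theorem contDiff_partialDeriv {φ : R3 → ℝ} (h : ContDiff ℝ ∞ φ) (i : Fin 3) :
    ContDiff ℝ ∞ (partialDeriv i φ) :=
  (h.fderiv_right (m := ∞) (by simp)).clm_apply contDiff_const

theorem hasCompactSupport_partialDeriv {φ : R3 → ℝ} (h : HasCompactSupport φ) (i : Fin 3) :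
    HasCompactSupport (partialDeriv i φ) :=
  h.fderiv_apply ℝ _

theorem hasFDerivAt_profile (R : ℝ) (x y : R3) :
    HasFDerivAt (fun y : R3 => 1 - ‖y - x‖ ^ 2 / R ^ 2)
      (-((R ^ 2)⁻¹ • (2 • innerSL ℝ (y - x)))) y := by
  have h := ((hasFDerivAt_id (𝕜 := ℝ) y).sub_const x).norm_sq
  have h2 := (h.const_mul ((R ^ 2)⁻¹)).const_sub 1
  refine (h2.congr_fderiv ?_).congr_of_eventuallyEq (Eventually.of_forall fun z => ?_)
  · ext z; simp
  · simp only [id]; ring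

/-- A smooth radial function supported in the closed ball of radius `R` around `x`. -/
noncomputable def radialBump (R : ℝ) (x y : R3) : ℝ := glue (1 - ‖y - x‖ ^ 2 / R ^ 2)

theorem contDiff_radialBump (R : ℝ) (x : R3) : ContDiff ℝ ∞ (radialBump R x) := by
  unfold radialBump
  exact contDiff_glue.comp
    (contDiff_const.sub (((contDiff_id.sub contDiff_const).norm_sq ℝ).div_const _))

theorem profile_neg {R : ℝ} (hR : 0 < R) {x y : R3} (hy : y ∉ Metric.closedBall x R) :
    1 - ‖y - x‖ ^ 2 / R ^ 2 < 0 := by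
  rw [Metric.mem_closedBall, dist_eq_norm, not_le] at hy
  rw [sub_neg, one_lt_div (by positivity)]
  gcongr

theorem hasCompactSupport_radialBump {R : ℝ} (hR : 0 < R) (x : R3) :
    HasCompactSupport (radialBump R x) :=
  HasCompactSupport.intro (isCompact_closedBall x R) fun _ hy =>
    glue_of_nonpos (profile_neg hR hy).le

theorem partialDeriv_radialBump (i : Fin 3) (R : ℝ) (x : R3) :
    partialDeriv i (radialBump R x) =
      fun y => expNegInvGlue (1 - ‖y - x‖ ^ 2 / R ^ 2) * (-2 * (y i - x i) / R ^ 2) := by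
  funext y
  refine (partialDeriv_eq
    ((hasDerivAt_glue _).comp_hasFDerivAt y (hasFDerivAt_profile R x y))).trans ?_
  simp [innerSL_apply_apply, EuclideanSpace.inner_single_right]
  ring_nf

theorem sum_partialDeriv_radialBump (R : ℝ) (x y : R3) :
    ∑ i, partialDeriv i (partialDeriv i (radialBump R x)) y =
      deriv expNegInvGlue (1 - ‖y - x‖ ^ 2 / R ^ 2) * (4 * ‖y - x‖ ^ 2 / R ^ 4)
        - 6 / R ^ 2 * expNegInvGlue (1 - ‖y - x‖ ^ 2 / R ^ 2) := by
  have key : ∀ i, partialDeriv i (partialDeriv i (radialBump R x)) y =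
      deriv expNegInvGlue (1 - ‖y - x‖ ^ 2 / R ^ 2) * (4 * (y i - x i) ^ 2 / R ^ 4)
        - 2 / R ^ 2 * expNegInvGlue (1 - ‖y - x‖ ^ 2 / R ^ 2) := by
    intro i
    rw [partialDeriv_radialBump]
    have h1 := (hasDerivAt_expNegInvGlue _).comp_hasFDerivAt y (hasFDerivAt_profile R x y)
    have h2 : HasFDerivAt (fun y : R3 => -2 * (y i - x i) / R ^ 2)
        ((-2 / R ^ 2) • (EuclideanSpace.proj i : R3 →L[ℝ] ℝ)) y := by
      have := (((EuclideanSpace.proj i : R3 →L[ℝ] ℝ).hasFDerivAt (x := y)).sub_const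
        (x i)).const_mul (-2 / R ^ 2)
      refine this.congr_of_eventuallyEq (Eventually.of_forall fun z => ?_)
      simp
      ring
    refine (partialDeriv_eq (h1.mul h2)).trans ?_
    simp [innerSL_apply_apply, EuclideanSpace.inner_single_right]
    ring
  simp_rw [key]
  rw [Finset.sum_sub_distrib, ← Finset.mul_sum, EuclideanSpace.real_norm_sq_eq (y - x)]
  simp [Fin.sum_univ_three]
  ring

/-! ### Radial averages and a Liouville theorem -/

/-- The smooth radial averaging kernel of radius `R` around `x`. -/
noncomputable def radialKernel (R : ℝ) (x y : R3) : ℝ :=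
  expNegInvGlue (1 - ‖y - x‖ ^ 2 / R ^ 2) / R ^ 3

theorem continuous_radialKernel (R : ℝ) (x : R3) : Continuous (radialKernel R x) := by
  unfold radialKernel
  exact (continuous_expNegInvGlue.comp (by fun_prop)).div_const _

theorem radialKernel_eq_zero {R : ℝ} (hR : 0 < R) {x y : R3} (hy : y ∉ Metric.closedBall x R) :
    radialKernel R x y = 0 := by
  rw [radialKernel, expNegInvGlue.zero_of_nonpos (profile_neg hR hy).le, zero_div]

theorem hasCompactSupport_radialKernel {R : ℝ} (hR : 0 < R) (x : R3) :
    HasCompactSupport (radialKernel R x) :=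
  HasCompactSupport.intro (isCompact_closedBall x R) fun _ hy => radialKernel_eq_zero hR hy

theorem integrable_mul_of_hasCompactSupport {v f : R3 → ℝ} (hv : MemLp v 2 volume)
    (hf : Continuous f) (hf' : HasCompactSupport f) : Integrable (fun x => v x * f x) := by
  simpa only [smul_eq_mul, mul_comm] using
    (hv.locallyIntegrable one_le_two).integrable_smul_left_of_hasCompactSupport hf hf'

/-- The derivative of the averaging kernel in the radius is, up to a factor, a Laplacian. -/
theorem hasDerivAt_radialKernel {R : ℝ} (hR : 0 < R) (x y : R3) :
    HasDerivAt (fun r => radialKernel r x y)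
      ((2 * R ^ 2)⁻¹ * ∑ i, partialDeriv i (partialDeriv i (radialBump R x)) y) R := by
  have h1 : HasDerivAt (fun r : ℝ => 1 - ‖y - x‖ ^ 2 / r ^ 2) (2 * ‖y - x‖ ^ 2 / R ^ 3) R := by
    have := ((((hasDerivAt_id R).pow 2).inv (by simpa using hR.ne')).const_mul (‖y - x‖ ^ 2)).const_sub 1
    refine (this.congr_deriv ?_).congr_of_eventuallyEq (Eventually.of_forall fun z => ?_)
    · simp only [id, Pi.pow_apply]
      field_simp
      push_cast
      ring
    · simp [div_eq_mul_inv]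
  have h2 := ((hasDerivAt_expNegInvGlue _).comp R h1).div ((hasDerivAt_id R).pow 3)
    (pow_ne_zero 3 hR.ne')
  refine (h2.congr_deriv ?_).congr_of_eventuallyEq (Eventually.of_forall fun z => ?_)
  -- The normalization `R^3`, with exponent the dimension, is what makes the two expressions agree:
  -- both equal `2ρ²e'/R⁶ - 3e/R⁴`, with `ρ = ‖y - x‖`, `e` the profile and `e'` its derivative.
  · rw [sum_partialDeriv_radialBump]
    simp only [id, Function.comp_apply]
    simp
    field_simp
    ring
  · simp [radialKernel]

theorem sum_partialDeriv_radialBump_eq_zero {R : ℝ} (hR : 0 < R) {x y : R3}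
    (hy : y ∉ Metric.closedBall x R) :
    ∑ i, partialDeriv i (partialDeriv i (radialBump R x)) y = 0 := by
  rw [sum_partialDeriv_radialBump, deriv_expNegInvGlue_of_neg (profile_neg hR hy),
    expNegInvGlue.zero_of_nonpos (profile_neg hR hy).le]
  simp

/-- The smooth radial average of `v` at scale `R` around `x`. -/
noncomputable def radialAverage (v : R3 → ℝ) (x : R3) (R : ℝ) : ℝ :=
  ∫ y, v y * radialKernel R x y

theorem hasDerivAt_radialAverage {v : R3 → ℝ} (hv : MemLp v 2 volume) (x : R3)
    {R : ℝ} (hR : 0 < R) :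
    HasDerivAt (radialAverage v x) (∫ y, v y * ((2 * R ^ 2)⁻¹ *
      ∑ i, partialDeriv i (partialDeriv i (radialBump R x)) y)) R := by
  -- Joint continuity in radius and point on a compact set bounds the differentiated kernel
  -- uniformly for radii in `(R/2, 2R)`, so a multiple of `‖v‖` on a fixed ball dominates.
  let D : ℝ × R3 → ℝ := fun p => (2 * p.1 ^ 2)⁻¹ *
    (deriv expNegInvGlue (1 - ‖p.2 - x‖ ^ 2 / p.1 ^ 2) * (4 * ‖p.2 - x‖ ^ 2 / p.1 ^ 4)
        - 6 / p.1 ^ 2 * expNegInvGlue (1 - ‖p.2 - x‖ ^ 2 / p.1 ^ 2))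
  have hD : ∀ r y, (2 * r ^ 2)⁻¹ * ∑ i, partialDeriv i (partialDeriv i (radialBump r x)) y
      = D (r, y) := fun r y => by rw [sum_partialDeriv_radialBump]
  have hDc : ContinuousOn D (Set.Icc (R / 2) (2 * R) ×ˢ Metric.closedBall x (2 * R)) := by
    have hne : ∀ p ∈ Set.Icc (R / 2) (2 * R) ×ˢ Metric.closedBall x (2 * R), p.1 ≠ 0 :=
      fun p hp => (lt_of_lt_of_le (half_pos hR) hp.1.1).ne'
    have h0 : ContinuousOn (fun p : ℝ × R3 => 1 - ‖p.2 - x‖ ^ 2 / p.1 ^ 2)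
        (Set.Icc (R / 2) (2 * R) ×ˢ Metric.closedBall x (2 * R)) := by
      refine continuousOn_const.sub (ContinuousOn.div (by fun_prop) (by fun_prop) ?_)
      exact fun p hp => pow_ne_zero _ (hne p hp)
    refine ContinuousOn.mul (ContinuousOn.inv₀ (by fun_prop) ?_) (ContinuousOn.sub
      (ContinuousOn.mul (continuous_deriv_expNegInvGlue.comp_continuousOn h0)
        (ContinuousOn.div (by fun_prop) (by fun_prop) ?_))
      (ContinuousOn.mul (ContinuousOn.div (by fun_prop) (by fun_prop) ?_)
        (continuous_expNegInvGlue.comp_continuousOn h0)))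
    · exact fun p hp => mul_ne_zero two_ne_zero (pow_ne_zero _ (hne p hp))
    · exact fun p hp => pow_ne_zero _ (hne p hp)
    · exact fun p hp => pow_ne_zero _ (hne p hp)
  obtain ⟨M, hM⟩ := (isCompact_Icc.prod (isCompact_closedBall x (2 * R))).exists_bound_of_continuousOn
    hDc
  have hint : Integrable ((Metric.closedBall x (2 * R)).indicator fun y => M * ‖v y‖) := by
    rw [integrable_indicator_iff measurableSet_closedBall]
    exact ((hv.locallyIntegrable one_le_two).integrableOn_isCompact
      (isCompact_closedBall x (2 * R))).norm.const_mul M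
  have hmem : Set.Ioo (R / 2) (2 * R) ∈ 𝓝 R := Ioo_mem_nhds (by linarith) (by linarith)
  refine (hasDerivAt_integral_of_dominated_loc_of_deriv_le
    (F := fun r y => v y * radialKernel r x y)
    (F' := fun r y => v y * ((2 * r ^ 2)⁻¹ *
      ∑ i, partialDeriv i (partialDeriv i (radialBump r x)) y)) hmem
    (Eventually.of_forall fun r => hv.1.mul (continuous_radialKernel r x).aestronglyMeasurable)
    (integrable_mul_of_hasCompactSupport hv (continuous_radialKernel R x)
      (hasCompactSupport_radialKernel hR x)) ?_ ?_ hint ?_).2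
  · refine hv.1.mul (Continuous.aestronglyMeasurable ?_)
    exact continuous_const.mul (continuous_finsetSum _ fun i _ =>
      (contDiff_partialDeriv (contDiff_partialDeriv (contDiff_radialBump R x) i) i).continuous)
  · refine Eventually.of_forall fun y r hr => ?_
    have hr0 : 0 < r := lt_trans (half_pos hR) hr.1
    by_cases hy : y ∈ Metric.closedBall x (2 * R)
    · rw [Set.indicator_of_mem hy, hD, norm_mul, mul_comm]
      exact mul_le_mul_of_nonneg_right (hM (r, y) ⟨⟨hr.1.le, hr.2.le⟩, hy⟩) (norm_nonneg _)
    · rw [Set.indicator_of_notMem hy, sum_partialDeriv_radialBump_eq_zero hr0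
        (fun h => hy (Metric.closedBall_subset_closedBall hr.2.le h))]
      simp
  · exact Eventually.of_forall fun y r hr =>
      (hasDerivAt_radialKernel (lt_trans (half_pos hR) hr.1) x y).const_mul (v y)

theorem integral_comp_radial (f : R3 → ℝ) (x : R3) {R : ℝ} (hR : 0 < R) :
    ∫ y, f (R⁻¹ • (y - x)) = R ^ 3 * ∫ y, f y := by
  rw [integral_sub_right_eq_self (fun y => f (R⁻¹ • y)) x,
    Measure.integral_comp_inv_smul_of_nonneg _ _ hR.le]
  simp

theorem radialKernel_eq {R : ℝ} (hR : 0 < R) (x y : R3) :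
    radialKernel R x y = radialKernel 1 0 (R⁻¹ • (y - x)) / R ^ 3 := by
  simp only [radialKernel, sub_zero, norm_smul, norm_inv, Real.norm_eq_abs, abs_of_pos hR, one_pow,
    div_one]
  congr 3
  field_simp

theorem integral_radialKernel {R : ℝ} (hR : 0 < R) (x : R3) :
    ∫ y, radialKernel R x y = ∫ y, radialKernel 1 0 y := by
  simp_rw [radialKernel_eq hR x]
  rw [integral_div, integral_comp_radial _ x hR]
  field_simp

theorem integral_radialKernel_sq {R : ℝ} (hR : 0 < R) (x : R3) :
    ∫ y, radialKernel R x y ^ 2 = (∫ y, radialKernel 1 0 y ^ 2) / R ^ 3 := by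
  simp_rw [radialKernel_eq hR x, div_pow]
  rw [integral_div, integral_comp_radial (fun y => radialKernel 1 0 y ^ 2) x hR]
  field_simp

theorem integral_radialKernel_pos : 0 < ∫ y, radialKernel 1 0 y := by
  have hnn : ∀ y, 0 ≤ radialKernel 1 0 y := fun y =>
    div_nonneg (expNegInvGlue.nonneg _) (by norm_num)
  refine (continuous_radialKernel 1 0).integral_pos_of_hasCompactSupport_nonneg_nonzero
    (hasCompactSupport_radialKernel one_pos 0) hnn (x := 0) ?_
  simp [radialKernel]

/-- Young's inequality with weight `R`: the squared kernel integrates to order `R⁻³`, so this weight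
leaves two terms that both vanish as `R → ∞`. -/
theorem abs_radialAverage_le {v : R3 → ℝ} (hv : MemLp v 2 volume) (x : R3) {R : ℝ} (hR : 0 < R) :
    |radialAverage v x R| ≤
      (∫ y, v y ^ 2) / (2 * R) + (∫ y, radialKernel 1 0 y ^ 2) / (2 * R ^ 2) := by
  have hk : Integrable fun y => radialKernel R x y ^ 2 :=
    ((continuous_radialKernel R x).pow 2).integrable_of_hasCompactSupport
      (by simpa only [sq] using (hasCompactSupport_radialKernel hR x).mul_left)
  calc |radialAverage v x R| ≤ ∫ y, |v y * radialKernel R x y| := abs_integral_le_integral_abs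
    _ ≤ ∫ y, (v y ^ 2 / (2 * R) + radialKernel R x y ^ 2 * (R / 2)) := by
      refine integral_mono (integrable_mul_of_hasCompactSupport hv (continuous_radialKernel R x)
        (hasCompactSupport_radialKernel hR x)).abs
        ((hv.integrable_sq.div_const _).add (hk.mul_const _)) fun y => ?_
      simp only [abs_mul]
      have h := sq_nonneg (|v y| - R * |radialKernel R x y|)
      have e1 := sq_abs (v y)
      have e2 := sq_abs (radialKernel R x y)
      rw [← e1, ← e2, div_add' _ _ _ (by positivity), le_div_iff₀ (by positivity)]
      nlinarith
    _ = _ := by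
      rw [integral_add (hv.integrable_sq.div_const _) (hk.mul_const _), integral_div,
        integral_mul_const, integral_radialKernel_sq hR x]
      field_simp

/-- The radius derivative tests `v` against the Laplacian of a bump, so the average does not depend
on the radius; letting the radius tend to infinity shows that it is zero. -/
theorem radialAverage_eq_zero {v : R3 → ℝ} (hv : MemLp v 2 volume)
    (hh : ∀ ψ : R3 → ℝ, ContDiff ℝ ∞ ψ → HasCompactSupport ψ →
      ∫ x, v x * ∑ i, partialDeriv i (partialDeriv i ψ) x = 0) (x : R3) {R : ℝ} (hR : 0 < R) :
    radialAverage v x R = 0 := by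
  have hd : ∀ r : ℝ, 0 < r → HasDerivAt (radialAverage v x) 0 r := fun r hr => by
    refine (hasDerivAt_radialAverage hv x hr).congr_deriv ?_
    simp_rw [mul_left_comm (v _)]
    rw [integral_const_mul, hh _ (contDiff_radialBump r x) (hasCompactSupport_radialBump hr x),
      mul_zero]
  have hc : ∀ r : ℝ, 0 < r → radialAverage v x R = radialAverage v x r := fun r hr =>
    isOpen_Ioi.is_const_of_deriv_eq_zero (s := Set.Ioi (0 : ℝ)) isPreconnected_Ioi
      (fun t ht => (hd t ht).differentiableAt.differentiableWithinAt)
      (fun t ht => (hd t ht).deriv) hR hr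
  have hlim : Tendsto (fun r : ℝ => (∫ y, v y ^ 2) / (2 * r) +
      (∫ y, radialKernel 1 0 y ^ 2) / (2 * r ^ 2)) atTop (𝓝 (0 + 0)) := by
    refine Tendsto.add (Tendsto.div_atTop tendsto_const_nhds ?_)
      (Tendsto.div_atTop tendsto_const_nhds ?_)
    · exact tendsto_id.const_mul_atTop two_pos
    · exact (tendsto_pow_atTop two_ne_zero).const_mul_atTop two_pos
  have : |radialAverage v x R| ≤ 0 + 0 := by
    refine ge_of_tendsto hlim ?_
    filter_upwards [eventually_gt_atTop 0] with r hr
    rw [hc r hr]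
    exact abs_radialAverage_le hv x hr
  simpa using this

/-- A square integrable weakly harmonic function on `ℝ³` vanishes. -/
theorem ae_eq_zero_of_weakly_harmonic {v : R3 → ℝ} (hv : MemLp v 2 volume)
    (hh : ∀ ψ : R3 → ℝ, ContDiff ℝ ∞ ψ → HasCompactSupport ψ →
      ∫ x, v x * ∑ i, partialDeriv i (partialDeriv i ψ) x = 0) : v =ᵐ[volume] 0 := by
  set c := ∫ y, radialKernel 1 0 y
  have hc0 : 0 < c := integral_radialKernel_pos
  have hloc := hv.locallyIntegrable one_le_two
  filter_upwards [(Besicovitch.vitaliFamily (volume : Measure R3)).ae_tendsto_average_norm_sub hloc]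
    with x h₀
  have h1 := h₀.comp (Besicovitch.tendsto_filterAt volume x)
  -- At a Lebesgue point the kernels divided by their mass `c` form an approximate identity as the
  -- radius shrinks, so the vanishing averages converge to `v x`.
  have h2 := tendsto_integral_smul_of_tendsto_average_norm_sub
    (g := fun R y => c⁻¹ * radialKernel R x y)
    (K := c⁻¹ * (volume : Measure R3).real (Metric.closedBall 0 1)) h1 ?_ ?_ ?_ ?_
  · have h3 : Tendsto (fun R : ℝ => ∫ y, (c⁻¹ * radialKernel R x y) • v y) (𝓝[>] 0) (𝓝 0) := by
      refine tendsto_const_nhds.congr' ?_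
      filter_upwards [self_mem_nhdsWithin] with R hR
      have := radialAverage_eq_zero hv hh x hR
      rw [radialAverage] at this
      simp_rw [smul_eq_mul, mul_assoc, mul_comm _ (v _)]
      rw [integral_const_mul, this, mul_zero]
    exact tendsto_nhds_unique h2 h3
  · exact Eventually.of_forall fun R => hloc.integrableOn_isCompact (isCompact_closedBall x R)
  · refine tendsto_const_nhds.congr' ?_
    filter_upwards [self_mem_nhdsWithin] with R hR
    rw [integral_const_mul, integral_radialKernel hR x, inv_mul_cancel₀ hc0.ne']
  · filter_upwards [self_mem_nhdsWithin] with R hR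
    intro y hy
    by_contra h
    exact hy (by simp [radialKernel_eq_zero hR h])
  · filter_upwards [self_mem_nhdsWithin] with R hR y
    have hR : 0 < R := hR
    have hb : (volume : Measure R3).real (Metric.closedBall x R) =
        R ^ 3 * (volume : Measure R3).real (Metric.closedBall 0 1) := by
      rw [measureReal_def, Measure.addHaar_closedBall' _ _ hR.le]
      simp [measureReal_def, hR.le]
    have hpos : 0 < (volume : Measure R3).real (Metric.closedBall (0 : R3) 1) :=
      ENNReal.toReal_pos (Metric.measure_closedBall_pos _ _ one_pos).ne'
        measure_closedBall_lt_top.ne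
    rw [hb, mul_div_mul_right _ _ hpos.ne', abs_mul, abs_of_pos (inv_pos.2 hc0), div_eq_mul_inv]
    refine mul_le_mul_of_nonneg_left ?_ (inv_pos.2 hc0).le
    rw [radialKernel, abs_of_nonneg (div_nonneg (expNegInvGlue.nonneg _) (by positivity)),
      div_eq_mul_inv]
    exact mul_le_of_le_one_left (by positivity) (expNegInvGlue_le_one _)

/-! ### Gradients and rotations of test functions -/

theorem inner_gradient_eq (v : R3) (φ : R3 → ℝ) (x : R3) :
    inner ℝ v (gradient φ x) = ∑ i, v i * partialDeriv i φ x := by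
  rw [real_inner_comm, gradient, InnerProductSpace.toDual_symm_apply]
  conv_lhs => rw [← (EuclideanSpace.basisFun (Fin 3) ℝ).sum_repr v]
  simp [partialDeriv]

theorem continuous_gradient {φ : R3 → ℝ} (h : ContDiff ℝ ∞ φ) : Continuous (gradient φ) :=
  (InnerProductSpace.toDual ℝ R3).symm.continuous.comp (h.continuous_fderiv (by simp))

theorem memLp_gradient {φ : R3 → ℝ} (h : ContDiff ℝ ∞ φ) (h' : HasCompactSupport φ) :
    MemLp (gradient φ) 2 volume :=
  (continuous_gradient h).memLp_of_hasCompactSupport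
    ((h'.fderiv ℝ).comp_left (map_zero (InnerProductSpace.toDual ℝ R3).symm))

/-- The field whose inner product with `v` is `v k * ∂ᵢ φ - v i * ∂ₖ φ`. -/
noncomputable def rotField (i k : Fin 3) (φ : R3 → ℝ) (x : R3) : R3 :=
  partialDeriv i φ x • EuclideanSpace.single k 1 - partialDeriv k φ x • EuclideanSpace.single i 1

theorem inner_rotField (i k : Fin 3) (v : R3) (φ : R3 → ℝ) (x : R3) :
    inner ℝ v (rotField i k φ x) = v k * partialDeriv i φ x - v i * partialDeriv k φ x := by
  simp [rotField, inner_sub_right, inner_smul_right, EuclideanSpace.inner_single_right]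
  ring

theorem memLp_rotField {φ : R3 → ℝ} (h : ContDiff ℝ ∞ φ) (h' : HasCompactSupport φ)
    (i k : Fin 3) : MemLp (rotField i k φ) 2 volume := by
  refine Continuous.memLp_of_hasCompactSupport ?_ ?_
  · exact ((contDiff_partialDeriv h i).continuous.smul continuous_const).sub
      ((contDiff_partialDeriv h k).continuous.smul continuous_const)
  · exact ((hasCompactSupport_partialDeriv h' i).smul_right).sub
      ((hasCompactSupport_partialDeriv h' k).smul_right)

theorem partialDeriv_comm {φ : R3 → ℝ} (h : ContDiff ℝ ∞ φ) (i k : Fin 3) :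
    partialDeriv i (partialDeriv k φ) = partialDeriv k (partialDeriv i φ) := by
  have hd : Differentiable ℝ (fderiv ℝ φ) :=
    (h.fderiv_right (m := ∞) (by simp)).differentiable (by simp)
  have key : ∀ a b : Fin 3, ∀ x, partialDeriv a (partialDeriv b φ) x =
      fderiv ℝ (fderiv ℝ φ) x (EuclideanSpace.single a 1) (EuclideanSpace.single b 1) := by
    intro a b x
    exact (partialDeriv_eq ((hd x).hasFDerivAt.clm_apply (hasFDerivAt_const _ x))).trans (by simp)
  funext x
  rw [key, key]
  exact (h.contDiffAt.isSymmSndFDerivAt (by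
    rw [minSmoothness_of_isRCLikeNormedField]; exact WithTop.coe_le_coe.2 le_top)).eq _ _

theorem integrable_coord_mul {v : R3 → R3} (hv : MemLp v 2 volume) {f : R3 → ℝ}
    (hf : Continuous f) (hf' : HasCompactSupport f) (k : Fin 3) :
    Integrable (fun x => v x k * f x) :=
  integrable_mul_of_hasCompactSupport
    (hv.continuousLinearMap_comp (EuclideanSpace.proj k : R3 →L[ℝ] ℝ)) hf hf'

/-- Square integrable fields on `ℝ³` which are both divergence free and curl free vanish. -/
theorem ae_eq_zero_of_weakDivFree_of_weakCurlFree {v : R3 → R3} (hv : MemLp v 2 volume)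
    (hdiv : WeakDivFree v) (hcurl : WeakCurlFree v) : v =ᵐ[volume] 0 := by
  have hk : ∀ k : Fin 3, (fun x => v x k) =ᵐ[volume] 0 := by
    intro k
    refine ae_eq_zero_of_weakly_harmonic
      (hv.continuousLinearMap_comp (EuclideanSpace.proj k : R3 →L[ℝ] ℝ)) fun ψ hψ hψ' => ?_
    have hi : ∀ a b c : Fin 3, Integrable fun x => v x a * partialDeriv b (partialDeriv c ψ) x :=
      fun a b c => integrable_coord_mul hv
        (contDiff_partialDeriv (contDiff_partialDeriv hψ c) b).continuous
        (hasCompactSupport_partialDeriv (hasCompactSupport_partialDeriv hψ' c) b) a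
    -- Weak form of `Δvₖ = ∂ₖ div v`: the divergence is tested with `∂ₖψ`, and the curl condition
    -- with `∂ᵢψ` exchanges the indices.
    have h1 := hdiv (partialDeriv k ψ) (contDiff_partialDeriv hψ k)
      (hasCompactSupport_partialDeriv hψ' k)
    simp_rw [inner_gradient_eq] at h1
    rw [integral_finsetSum _ fun i _ => hi i i k] at h1
    simp_rw [Finset.mul_sum]
    refine (integral_finsetSum _ fun i _ => hi k i i).trans (Eq.trans ?_ h1)
    refine Finset.sum_congr rfl fun i _ => ?_
    rw [partialDeriv_comm hψ i k]
    exact hcurl _ (contDiff_partialDeriv hψ i) (hasCompactSupport_partialDeriv hψ' i) i k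
  filter_upwards [hk 0, hk 1, hk 2] with x h0 h1 h2
  ext i
  fin_cases i
  · exact h0
  · exact h1
  · exact h2

/-! ### Helmholtz decomposition in `L²` -/

/-- The space of square integrable fields on `ℝ³`. -/
abbrev L2Field : Type := Lp R3 2 (volume : Measure R3)

/-- The span of the gradients of test functions. -/
noncomputable def gradSpace : Submodule ℝ L2Field :=
  Submodule.span ℝ {g | ∃ φ : R3 → ℝ, ContDiff ℝ ∞ φ ∧ HasCompactSupport φ ∧
    g =ᵐ[volume] gradient φ}

/-- The span of the curls of test functions. -/
noncomputable def rotSpace : Submodule ℝ L2Field :=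
  Submodule.span ℝ {g | ∃ (φ : R3 → ℝ) (i k : Fin 3), ContDiff ℝ ∞ φ ∧ HasCompactSupport φ ∧
    g =ᵐ[volume] rotField i k φ}

theorem mem_orthogonal_span {S : Set L2Field} {v : L2Field} :
    v ∈ (Submodule.span ℝ S)ᗮ ↔ ∀ u ∈ S, inner ℝ v u = 0 := by
  refine ⟨fun h u hu => (Submodule.mem_orthogonal' _ _).1 h u (Submodule.subset_span hu),
    fun h => (Submodule.mem_orthogonal' _ _).2 fun u hu => ?_⟩
  induction hu using Submodule.span_induction with
  | mem x hx => exact h x hx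
  | zero => exact inner_zero_right _
  | add x y _ _ hx hy => rw [inner_add_right, hx, hy, add_zero]
  | smul a x _ hx => rw [inner_smul_right, hx, mul_zero]

theorem inner_eq_integral_of_ae_eq {f g : L2Field} {u v : R3 → R3} (hf : f =ᵐ[volume] u)
    (hg : g =ᵐ[volume] v) : inner ℝ f g = ∫ x, inner ℝ (u x) (v x) := by
  rw [L2.inner_def]
  refine integral_congr_ae ?_
  filter_upwards [hf, hg] with x h1 h2
  rw [h1, h2]

theorem mem_gradSpace_orthogonal_iff {v : L2Field} {u : R3 → R3} (hu : v =ᵐ[volume] u) :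
    v ∈ gradSpaceᗮ ↔ WeakDivFree u := by
  rw [gradSpace, mem_orthogonal_span]
  constructor
  · intro h φ hφ hφ'
    rw [← inner_eq_integral_of_ae_eq hu (memLp_gradient hφ hφ').coeFn_toLp]
    exact h _ ⟨φ, hφ, hφ', (memLp_gradient hφ hφ').coeFn_toLp⟩
  · rintro h g ⟨φ, hφ, hφ', hg⟩
    rw [inner_eq_integral_of_ae_eq hu hg]
    exact h φ hφ hφ'

theorem mem_rotSpace_orthogonal_iff {v : L2Field} {u : R3 → R3} (hu : v =ᵐ[volume] u) :
    v ∈ rotSpaceᗮ ↔ WeakCurlFree u := by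
  have hum : MemLp u 2 volume := (memLp_congr_ae hu).1 (Lp.memLp v)
  have key : ∀ (φ : R3 → ℝ) (i k : Fin 3), ContDiff ℝ ∞ φ → HasCompactSupport φ →
      ∫ x, inner ℝ (u x) (rotField i k φ x) =
        (∫ x, u x k * partialDeriv i φ x) - ∫ x, u x i * partialDeriv k φ x := by
    intro φ i k hφ hφ'
    simp_rw [inner_rotField]
    exact integral_sub
      (integrable_coord_mul hum (contDiff_partialDeriv hφ i).continuous
        (hasCompactSupport_partialDeriv hφ' i) k)
      (integrable_coord_mul hum (contDiff_partialDeriv hφ k).continuous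
        (hasCompactSupport_partialDeriv hφ' k) i)
  rw [rotSpace, mem_orthogonal_span]
  constructor
  · intro h φ hφ hφ' i k
    rw [← sub_eq_zero, ← key φ i k hφ hφ',
      ← inner_eq_integral_of_ae_eq hu (memLp_rotField hφ hφ' i k).coeFn_toLp]
    exact h _ ⟨φ, i, k, hφ, hφ', (memLp_rotField hφ hφ' i k).coeFn_toLp⟩
  · rintro h g ⟨φ, i, k, hφ, hφ', hg⟩
    rw [inner_eq_integral_of_ae_eq hu hg, key φ i k hφ hφ', sub_eq_zero]
    exact h φ hφ hφ' i k

theorem eq_zero_of_mem_orthogonal {v : L2Field} (h1 : v ∈ gradSpaceᗮ) (h2 : v ∈ rotSpaceᗮ) :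
    v = 0 := by
  rw [Lp.eq_zero_iff_ae_eq_zero]
  exact ae_eq_zero_of_weakDivFree_of_weakCurlFree (Lp.memLp v)
    ((mem_gradSpace_orthogonal_iff ae_eq_rfl).1 h1) ((mem_rotSpace_orthogonal_iff ae_eq_rfl).1 h2)

theorem lineDeriv_eq_partialDeriv {φ : R3 → ℝ} (h : ContDiff ℝ ∞ φ) (i : Fin 3) (x : R3) :
    lineDeriv ℝ φ x (EuclideanSpace.single i 1) = partialDeriv i φ x :=
  (h.differentiable (by simp) x).lineDeriv_eq_fderiv

/-- Two partial derivatives, one on each factor, can be exchanged under the integral. -/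
theorem integral_lineDeriv_mul_partialDeriv_swap {K : NNReal} {f : R3 → ℝ} (hf : LipschitzWith K f)
    {φ : R3 → ℝ} (hφ : ContDiff ℝ ∞ φ) (hφ' : HasCompactSupport φ) (i k : Fin 3) :
    ∫ x, lineDeriv ℝ f x (EuclideanSpace.single i 1) * partialDeriv k φ x =
      ∫ x, lineDeriv ℝ f x (EuclideanSpace.single k 1) * partialDeriv i φ x := by
  -- One integration by parts puts both derivatives on the smooth factor, where they commute. Only
  -- Lipschitz regularity of `f` is used, which allows the kink of `ballPotential` on the sphere.
  have key : ∀ a b : Fin 3, ∫ x, lineDeriv ℝ f x (EuclideanSpace.single a 1) * partialDeriv b φ x =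
      - ∫ x, partialDeriv a (partialDeriv b φ) x * f x := by
    intro a b
    have hb := contDiff_partialDeriv hφ b
    obtain ⟨D, hD⟩ := hb.lipschitzWith_of_hasCompactSupport
      (hasCompactSupport_partialDeriv hφ' b) (by simp)
    rw [hf.integral_lineDeriv_mul_eq hD (hasCompactSupport_partialDeriv hφ' b), ← integral_neg]
    simp_rw [lineDeriv_neg, lineDeriv_eq_partialDeriv hb, neg_mul]
  rw [key, key, partialDeriv_comm hφ]

theorem gradSpace_le_rotSpace_orthogonal : gradSpace ≤ rotSpaceᗮ := by
  refine Submodule.span_le.2 ?_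
  rintro g ⟨φ, hφ, hφ', hg⟩
  rw [SetLike.mem_coe, mem_rotSpace_orthogonal_iff hg]
  intro ψ hψ hψ' i k
  obtain ⟨D, hD⟩ := hφ.lipschitzWith_of_hasCompactSupport hφ' (by simp)
  have hc : ∀ (x : R3) (a : Fin 3),
      gradient φ x a = lineDeriv ℝ φ x (EuclideanSpace.single a 1) := by
    intro x a
    rw [lineDeriv_eq_partialDeriv hφ]
    have := inner_gradient_eq (EuclideanSpace.single a 1) φ x
    rw [EuclideanSpace.inner_single_left] at this
    simpa [Pi.single_apply] using this
  simp_rw [hc]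
  exact integral_lineDeriv_mul_partialDeriv_swap hD hψ hψ' k i

theorem gradSpace_closure_le : gradSpace.topologicalClosure ≤ rotSpaceᗮ :=
  Submodule.topologicalClosure_minimal _ gradSpace_le_rotSpace_orthogonal
    (Submodule.isClosed_orthogonal _)

/-- Divergence free and curl free square integrable fields are orthogonal. -/
theorem inner_eq_zero_of_mem_orthogonal {a b : L2Field} (ha : a ∈ gradSpaceᗮ)
    (hb : b ∈ rotSpaceᗮ) : inner ℝ a b = 0 := by
  -- The remainder `b - p` is both divergence free and curl free, hence zero: a curl-free field is a
  -- limit of gradients.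
  set p := gradSpace.topologicalClosure.starProjection b
  have hp1 : p ∈ gradSpace.topologicalClosure := Submodule.starProjection_apply_mem _ _
  have h1 : b - p ∈ gradSpaceᗮ := by
    rw [← Submodule.orthogonal_closure]
    exact Submodule.sub_starProjection_mem_orthogonal b
  have h2 : b - p = 0 :=
    eq_zero_of_mem_orthogonal h1 (Submodule.sub_mem _ hb (gradSpace_closure_le hp1))
  rw [sub_eq_zero.1 h2]
  rw [← Submodule.orthogonal_closure] at ha
  exact (Submodule.mem_orthogonal' _ _).1 ha p hp1

/-- The field is minus the orthogonal projection of `f` onto the closure of the gradients. -/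
theorem exists_curlFree_add_divFree (f : L2Field) :
    ∃ h ∈ rotSpaceᗮ, f + h ∈ gradSpaceᗮ := by
  refine ⟨-gradSpace.topologicalClosure.starProjection f, ?_, ?_⟩
  · exact Submodule.neg_mem _ (gradSpace_closure_le (Submodule.starProjection_apply_mem _ _))
  · rw [← sub_eq_add_neg, ← Submodule.orthogonal_closure]
    exact Submodule.sub_starProjection_mem_orthogonal f

/-! ### The field of a uniformly magnetized ball -/

/-- The `k`-th component of the gradient of the Newtonian potential of the ball of radius `R`. -/
noncomputable def ballPotential (R : ℝ) (k : Fin 3) (x : R3) : ℝ :=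
  R ^ 3 / 3 * (x k / max R ‖x‖ ^ 3)

theorem abs_coord_le (x : R3) (k : Fin 3) : |x k| ≤ ‖x‖ := PiLp.norm_apply_le x k

theorem abs_div_cube_sub_le {R a b p q d : ℝ} (hR : 0 < R) (ha : R ≤ a) (hb : R ≤ b)
    (hab : |a - b| ≤ d) (hpq : |p - q| ≤ d) (hq : |q| ≤ b) :
    |p / a ^ 3 - q / b ^ 3| ≤ 4 / R ^ 3 * d := by
  have ha0 : 0 < a := hR.trans_le ha
  have hb0 : 0 < b := hR.trans_le hb
  have hd : 0 ≤ d := (abs_nonneg _).trans hab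
  -- Telescoping isolates four terms, each at most `d / R^3`; this is the origin of the factor 4.
  have e : p / a ^ 3 - q / b ^ 3 =
      (p - q) * (1 / a ^ 3) + q / b * (b - a) * (1 / (a * b ^ 2) + 1 / (a ^ 2 * b) + 1 / a ^ 3) := by
    field_simp
    ring
  have h1 : 1 / a ^ 3 ≤ 1 / R ^ 3 := by gcongr
  have h2 : 1 / (a * b ^ 2) ≤ 1 / R ^ 3 := by
    rw [show R ^ 3 = R * R ^ 2 by ring]; gcongr
  have h3 : 1 / (a ^ 2 * b) ≤ 1 / R ^ 3 := by
    rw [show R ^ 3 = R ^ 2 * R by ring]; gcongr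
  have h4 : |q / b| ≤ 1 := by
    rw [abs_div, abs_of_pos hb0]
    exact (div_le_one hb0).2 hq
  calc |p / a ^ 3 - q / b ^ 3| ≤ |p - q| * (1 / a ^ 3) +
        |q / b| * |b - a| * (1 / (a * b ^ 2) + 1 / (a ^ 2 * b) + 1 / a ^ 3) := by
        rw [e]
        refine (abs_add_le _ _).trans_eq ?_
        rw [abs_mul, abs_mul, abs_mul, abs_of_pos (show 0 < 1 / a ^ 3 by positivity),
          abs_of_pos (show 0 < 1 / (a * b ^ 2) + 1 / (a ^ 2 * b) + 1 / a ^ 3 by positivity)]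
    _ ≤ d * (1 / R ^ 3) + 1 * d * (1 / R ^ 3 + 1 / R ^ 3 + 1 / R ^ 3) := by
        rw [abs_sub_comm b a]
        gcongr
    _ = 4 / R ^ 3 * d := by ring

theorem lipschitzWith_ballPotential {R : ℝ} (hR : 0 < R) (k : Fin 3) :
    LipschitzWith (4 / 3) (ballPotential R k) := by
  refine LipschitzWith.of_dist_le_mul fun x y => ?_
  rw [Real.dist_eq, dist_eq_norm, ballPotential, ballPotential, ← mul_sub, abs_mul,
    abs_of_pos (by positivity)]
  have h := abs_div_cube_sub_le (p := x k) (q := y k) (d := ‖x - y‖) hR (le_max_left R ‖x‖)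
    (le_max_left R ‖y‖) ((abs_max_sub_max_le_max R ‖x‖ R ‖y‖).trans (by
      simpa using abs_norm_sub_norm_le x y))
    (abs_coord_le (x - y) k) ((abs_coord_le y k).trans (le_max_right _ _))
  calc R ^ 3 / 3 * |x k / max R ‖x‖ ^ 3 - y k / max R ‖y‖ ^ 3|
      ≤ R ^ 3 / 3 * (4 / R ^ 3 * ‖x - y‖) := by gcongr
    _ = 4 / 3 * ‖x - y‖ := by field_simp
    _ = _ := by simp

/-- The partial derivative `∂ᵢ` of the `k`-th component of `ballPotential`. -/
noncomputable def ballHessian (R : ℝ) (i k : Fin 3) (x : R3) : ℝ :=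
  lineDeriv ℝ (ballPotential R k) x (EuclideanSpace.single i 1)

theorem hasDerivAt_coord_add_smul (x : R3) (i k : Fin 3) :
    HasDerivAt (fun t : ℝ => (x + t • EuclideanSpace.single i (1 : ℝ) : R3) k)
      (if k = i then 1 else 0) 0 := by
  have h := ((hasDerivAt_id (0 : ℝ)).mul_const (if k = i then (1 : ℝ) else 0)).const_add (x k)
  refine (h.congr_deriv (by simp)).congr_of_eventuallyEq (Eventually.of_forall fun t => ?_)
  simp

theorem hasDerivAt_norm_add_smul {x : R3} (hx : x ≠ 0) (i : Fin 3) :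
    HasDerivAt (fun t : ℝ => ‖x + t • EuclideanSpace.single i (1 : ℝ)‖) (x i / ‖x‖) 0 := by
  have h0 : HasDerivAt (fun t : ℝ => x + t • (EuclideanSpace.single i (1 : ℝ) : R3))
      (EuclideanSpace.single i 1) 0 := by
    simpa using ((hasDerivAt_id (0 : ℝ)).smul_const
      (EuclideanSpace.single i (1 : ℝ) : R3)).const_add x
  have h1 := h0.norm_sq.sqrt (by simpa using hx)
  refine (h1.congr_deriv ?_).congr_of_eventuallyEq (Eventually.of_forall fun t => ?_)
  · simp [EuclideanSpace.inner_single_right]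
    field_simp
  · simp

theorem continuousAt_norm_add_smul (x : R3) (i : Fin 3) :
    ContinuousAt (fun t : ℝ => ‖x + t • EuclideanSpace.single i (1 : ℝ)‖) 0 := by
  fun_prop

theorem ballHessian_of_lt {R : ℝ} (hR : 0 < R) {x : R3} (hx : ‖x‖ < R) (i k : Fin 3) :
    ballHessian R i k x = if k = i then 1 / 3 else 0 := by
  have h : HasLineDerivAt ℝ (ballPotential R k) (if k = i then 1 / 3 else 0) x
      (EuclideanSpace.single i 1) := by
    have h1 := (hasDerivAt_coord_add_smul x i k).const_mul (1 / 3 : ℝ)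
    refine (h1.congr_deriv (by split_ifs <;> simp)).congr_of_eventuallyEq ?_
    have : ∀ᶠ t : ℝ in 𝓝 0, ‖x + t • EuclideanSpace.single i (1 : ℝ)‖ < R :=
      (continuousAt_norm_add_smul x i).eventually_lt continuousAt_const (by simpa using hx)
    filter_upwards [this] with t ht
    rw [ballPotential, max_eq_left ht.le]
    field_simp
  exact h.lineDeriv

theorem ballHessian_of_gt {R : ℝ} (hR : 0 < R) {x : R3} (hx : R < ‖x‖) (i k : Fin 3) :
    ballHessian R i k x =
      R ^ 3 / 3 * ((if k = i then 1 else 0) / ‖x‖ ^ 3 - 3 * (x i * x k) / ‖x‖ ^ 5) := by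
  have hx0 : 0 < ‖x‖ := hR.trans hx
  have h : HasLineDerivAt ℝ (ballPotential R k)
      (R ^ 3 / 3 * ((if k = i then 1 else 0) / ‖x‖ ^ 3 - 3 * (x i * x k) / ‖x‖ ^ 5)) x
      (EuclideanSpace.single i 1) := by
    have h1 := ((hasDerivAt_coord_add_smul x i k).div
      ((hasDerivAt_norm_add_smul (norm_pos_iff.1 hx0) i).pow 3)
      (by simpa using norm_pos_iff.1 hx0)).const_mul (R ^ 3 / 3)
    refine (h1.congr_deriv ?_).congr_of_eventuallyEq ?_
    · simp
      field_simp
      split_ifs <;> left <;> ring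
    · have : ∀ᶠ t : ℝ in 𝓝 0, R < ‖x + t • EuclideanSpace.single i (1 : ℝ)‖ :=
        continuousAt_const.eventually_lt (continuousAt_norm_add_smul x i) (by simpa using hx)
      filter_upwards [this] with t ht
      rw [ballPotential, max_eq_right ht.le]
      rfl
  exact h.lineDeriv

theorem ballHessian_symm {R : ℝ} (hR : 0 < R) {x : R3} (hx : ‖x‖ ≠ R) (i k : Fin 3) :
    ballHessian R i k x = ballHessian R k i x := by
  rcases lt_or_gt_of_ne hx with h | h
  · simp only [ballHessian_of_lt hR h, eq_comm]
  · simp only [ballHessian_of_gt hR h, eq_comm, mul_comm (x i)]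

/-- Poisson's equation off the sphere: inside, the trace is `3 · 1/3`; outside, `3/|x|³ -
3|x|²/|x|⁵` cancels. -/
theorem sum_ballHessian {R : ℝ} (hR : 0 < R) {x : R3} (hx : ‖x‖ ≠ R) :
    ∑ i, ballHessian R i i x = (Metric.ball (0 : R3) R).indicator 1 x := by
  rcases lt_or_gt_of_ne hx with h | h
  · rw [Set.indicator_of_mem (by simpa using h)]
    simp [ballHessian_of_lt hR h]
  · have hx0 : 0 < ‖x‖ := hR.trans h
    rw [Set.indicator_of_notMem (by simpa using h.le)]
    simp_rw [ballHessian_of_gt hR h]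
    rw [← Finset.mul_sum, Finset.sum_sub_distrib, ← Finset.sum_div, ← Finset.sum_div,
      ← Finset.mul_sum]
    simp_rw [← sq]
    rw [← EuclideanSpace.real_norm_sq_eq]
    simp
    right
    field_simp
    ring

/-- Dipole decay `|x|⁻³`, written so as to hold near the origin too; its square is integrable
because `6 > 3`. -/
theorem abs_ballHessian_le {R : ℝ} (hR : 0 < R) {x : R3} (hx : ‖x‖ ≠ R) (i k : Fin 3) :
    |ballHessian R i k x| ≤ 4 / 3 * (1 + R) ^ 3 * (1 + ‖x‖) ^ (-3 : ℝ) := by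
  have hpow : (1 + ‖x‖) ^ (-3 : ℝ) = 1 / (1 + ‖x‖) ^ 3 := by
    rw [Real.rpow_neg (by positivity), one_div]
    norm_cast
  rw [hpow, mul_one_div]
  rcases lt_or_gt_of_ne hx with h | h
  · have h1 : |ballHessian R i k x| ≤ 4 / 3 := by
      rw [ballHessian_of_lt hR h]
      split_ifs <;> norm_num
    refine h1.trans ?_
    rw [le_div_iff₀ (by positivity)]
    gcongr
  · have hx0 : 0 < ‖x‖ := hR.trans h
    have h1 : |ballHessian R i k x| ≤ R ^ 3 / 3 * (1 / ‖x‖ ^ 3 + 3 / ‖x‖ ^ 3) := by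
      rw [ballHessian_of_gt hR h, abs_mul, abs_of_pos (by positivity)]
      gcongr
      refine (abs_sub _ _).trans (add_le_add ?_ ?_)
      · rw [abs_div, abs_of_pos (show 0 < ‖x‖ ^ 3 by positivity)]
        gcongr
        split_ifs <;> simp
      · rw [abs_div, abs_of_pos (show 0 < ‖x‖ ^ 5 by positivity), abs_mul, abs_mul,
          div_le_div_iff₀ (by positivity) (by positivity), abs_of_pos (by norm_num : (0 : ℝ) < 3)]
        calc 3 * (|x i| * |x k|) * ‖x‖ ^ 3 ≤ 3 * (‖x‖ * ‖x‖) * ‖x‖ ^ 3 := by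
              gcongr <;> exact abs_coord_le x _
          _ = 3 * ‖x‖ ^ 5 := by ring
    refine h1.trans ?_
    have h2 : R ^ 3 * (1 + ‖x‖) ^ 3 ≤ (1 + R) ^ 3 * ‖x‖ ^ 3 := by
      rw [← mul_pow, ← mul_pow]
      gcongr ?_ ^ 3
      nlinarith
    rw [le_div_iff₀ (by positivity)]
    calc R ^ 3 / 3 * (1 / ‖x‖ ^ 3 + 3 / ‖x‖ ^ 3) * (1 + ‖x‖) ^ 3
        = 4 / 3 * (R ^ 3 * (1 + ‖x‖) ^ 3) / ‖x‖ ^ 3 := by ring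
      _ ≤ 4 / 3 * ((1 + R) ^ 3 * ‖x‖ ^ 3) / ‖x‖ ^ 3 := by gcongr
      _ = 4 / 3 * (1 + R) ^ 3 := by field_simp

theorem ae_norm_ne {R : ℝ} (hR : 0 < R) : ∀ᵐ x : R3, ‖x‖ ≠ R := by
  refine measure_mono_null (t := Metric.sphere (0 : R3) R) (fun x hx => ?_)
    (Measure.addHaar_sphere_of_ne_zero volume 0 hR.ne')
  simpa using hx

theorem memLp_ballHessian {R : ℝ} (hR : 0 < R) (i k : Fin 3) :
    MemLp (ballHessian R i k) 2 volume := by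
  have hb : MemLp (fun x : R3 => (1 + ‖x‖) ^ (-3 : ℝ)) 2 volume := by
    rw [memLp_two_iff_integrable_sq (Measurable.aestronglyMeasurable (by fun_prop))]
    have := integrable_one_add_norm (E := R3) (μ := volume) (r := 6) (by simp; norm_num)
    refine this.congr (Eventually.of_forall fun x => ?_)
    simp only
    rw [← Real.rpow_natCast, ← Real.rpow_mul (by positivity)]
    norm_num
  refine (hb.const_mul (4 / 3 * (1 + R) ^ 3)).mono
    (aestronglyMeasurable_lineDeriv (lipschitzWith_ballPotential hR k).continuous volume) ?_
  filter_upwards [ae_norm_ne hR] with x hx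
  exact (abs_ballHessian_le hR hx i k).trans (le_abs_self _)

/-- Minus the demagnetizing field of a ball of radius `R` with uniform magnetization `c`. -/
noncomputable def ballField (R : ℝ) (c x : R3) : R3 :=
  WithLp.toLp 2 fun i => ∑ k, c k * ballHessian R i k x

theorem ballField_apply (R : ℝ) (c x : R3) (i : Fin 3) :
    ballField R c x i = ∑ k, c k * ballHessian R i k x := rfl

/-- The demagnetizing factor of a ball is `1/3` in every direction. -/
theorem ballField_of_lt {R : ℝ} (hR : 0 < R) (c : R3) {x : R3} (hx : ‖x‖ < R) :
    ballField R c x = (1 / 3 : ℝ) • c := by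
  ext i
  rw [ballField_apply]
  simp [ballHessian_of_lt hR hx]
  ring

theorem memLp_ballField {R : ℝ} (hR : 0 < R) (c : R3) : MemLp (ballField R c) 2 volume := by
  have h : ballField R c = fun x => ∑ i, ContinuousLinearMap.toSpanSingleton ℝ
      (EuclideanSpace.single i (1 : ℝ) : R3) (∑ k, c k * ballHessian R i k x) := by
    funext x
    ext j
    simp [ballField_apply, Pi.single_apply]
  rw [h]
  refine memLp_finsetSum _ fun i _ => ContinuousLinearMap.comp_memLp' _ ?_
  exact memLp_finsetSum _ fun k _ => (memLp_ballHessian hR i k).const_mul _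

theorem weakCurlFree_ballField {R : ℝ} (hR : 0 < R) (c : R3) : WeakCurlFree (ballField R c) := by
  intro φ hφ hφ' i k
  have key : ∀ a b : Fin 3, ∫ x, ballField R c x a * partialDeriv b φ x =
      ∑ l, c l * ∫ x, ballHessian R a l x * partialDeriv b φ x := by
    intro a b
    simp_rw [ballField_apply, Finset.sum_mul, mul_assoc]
    rw [integral_finsetSum _ fun l _ => (integrable_mul_of_hasCompactSupport
      (memLp_ballHessian hR a l) (contDiff_partialDeriv hφ b).continuous
      (hasCompactSupport_partialDeriv hφ' b)).const_mul _]
    simp_rw [integral_const_mul]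
  rw [key, key]
  refine Finset.sum_congr rfl fun l _ => ?_
  exact congrArg _ (integral_lineDeriv_mul_partialDeriv_swap
    (lipschitzWith_ballPotential hR l) hφ hφ' k i)

/-- Symmetry of the Hessian and the exchange of derivatives turn `∂ᵢₖ` against `∂ᵢφ` into `∂ᵢᵢ`
against `∂ₖφ`, and the trace is the indicator. No surface term appears, since the potential gradient
is Lipschitz across the sphere. -/
theorem integral_inner_ballField_gradient {R : ℝ} (hR : 0 < R) (c : R3) {φ : R3 → ℝ}
    (hφ : ContDiff ℝ ∞ φ) (hφ' : HasCompactSupport φ) :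
    ∫ x, inner ℝ (ballField R c x) (gradient φ x) =
      ∫ x, inner ℝ ((Metric.ball (0 : R3) R).indicator (fun _ => c) x) (gradient φ x) := by
  have hi : ∀ a l b : Fin 3, Integrable fun x => ballHessian R a l x * partialDeriv b φ x :=
    fun a l b => integrable_mul_of_hasCompactSupport (memLp_ballHessian hR a l)
      (contDiff_partialDeriv hφ b).continuous (hasCompactSupport_partialDeriv hφ' b)
  have h1 : ∀ i k : Fin 3, ∫ x, ballHessian R i k x * partialDeriv i φ x =
      ∫ x, ballHessian R i i x * partialDeriv k φ x := by
    intro i k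
    calc ∫ x, ballHessian R i k x * partialDeriv i φ x
        = ∫ x, ballHessian R k i x * partialDeriv i φ x := by
          refine integral_congr_ae ?_
          filter_upwards [ae_norm_ne hR] with x hx
          rw [ballHessian_symm hR hx]
      _ = _ := integral_lineDeriv_mul_partialDeriv_swap
          (lipschitzWith_ballPotential hR i) hφ hφ' k i
  calc ∫ x, inner ℝ (ballField R c x) (gradient φ x)
      = ∑ i, ∑ k, c k * ∫ x, ballHessian R i k x * partialDeriv i φ x := by
        simp_rw [inner_gradient_eq, ballField_apply, Finset.sum_mul, mul_assoc]
        rw [integral_finsetSum _ fun i _ => integrable_finsetSum _ fun k _ =>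
          (hi i k i).const_mul _]
        refine Finset.sum_congr rfl fun i _ => ?_
        rw [integral_finsetSum _ fun k _ => (hi i k i).const_mul _]
        simp_rw [integral_const_mul]
    _ = ∑ i, ∑ k, c k * ∫ x, ballHessian R i i x * partialDeriv k φ x :=
        Finset.sum_congr rfl fun i _ => Finset.sum_congr rfl fun k _ => by rw [h1]
    _ = ∫ x, ∑ i, ∑ k, c k * (ballHessian R i i x * partialDeriv k φ x) := by
        rw [integral_finsetSum _ fun i _ => integrable_finsetSum _ fun k _ =>
          (hi i i k).const_mul _]
        refine Finset.sum_congr rfl fun i _ => ?_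
        rw [integral_finsetSum _ fun k _ => (hi i i k).const_mul _]
        simp_rw [integral_const_mul]
    _ = _ := by
        refine integral_congr_ae ?_
        filter_upwards [ae_norm_ne hR] with x hx
        rw [inner_gradient_eq, Finset.sum_comm]
        refine Finset.sum_congr rfl fun k _ => ?_
        rw [← Finset.mul_sum, ← Finset.sum_mul, sum_ballHessian hR hx]
        by_cases h : x ∈ Metric.ball (0 : R3) R
        · simp [Set.indicator_of_mem h]
        · simp [Set.indicator_of_notMem h]

/-! ### Magnetostatic energy on a ball -/

theorem IsDemagField.mem_orthogonal {Ω : Set R3} {m h : R3 → R3} (hh : IsDemagField Ω m h)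
    (hm : MemLp (Ω.indicator m) 2 volume) :
    hh.memLp.toLp h ∈ rotSpaceᗮ ∧ hm.toLp _ + hh.memLp.toLp h ∈ gradSpaceᗮ :=
  ⟨(mem_rotSpace_orthogonal_iff hh.memLp.coeFn_toLp).2 hh.curl_eq,
    (mem_gradSpace_orthogonal_iff ((Lp.coeFn_add _ _).trans
      (hm.coeFn_toLp.add hh.memLp.coeFn_toLp))).2 hh.div_eq⟩

theorem exists_isDemagField {Ω : Set R3} {m : R3 → R3} (hm : MemLp (Ω.indicator m) 2 volume) :
    ∃ h, IsDemagField Ω m h := by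
  obtain ⟨h, h1, h2⟩ := exists_curlFree_add_divFree (hm.toLp _)
  exact ⟨h, Lp.memLp h, (mem_gradSpace_orthogonal_iff ((Lp.coeFn_add _ _).trans
    (hm.coeFn_toLp.add ae_eq_rfl))).1 h2, (mem_rotSpace_orthogonal_iff ae_eq_rfl).1 h1⟩

theorem isDemagField_demagField {Ω : Set R3} {m : R3 → R3}
    (hm : MemLp (Ω.indicator m) 2 volume) : IsDemagField Ω m (demagField Ω m) := by
  rw [demagField, dif_pos (exists_isDemagField hm)]
  exact (exists_isDemagField hm).choose_spec

theorem setIntegral_inner_eq {Ω : Set R3} (hΩ : MeasurableSet Ω) {m h : R3 → R3}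
    (hm : MemLp (Ω.indicator m) 2 volume) (hh : MemLp h 2 volume) :
    ∫ x in Ω, inner ℝ (h x) (m x) = inner ℝ (hh.toLp h) (hm.toLp _) := by
  rw [inner_eq_integral_of_ae_eq hh.coeFn_toLp hm.coeFn_toLp, ← integral_indicator hΩ]
  congr 1
  funext x
  by_cases hx : x ∈ Ω
  · simp [hx]
  · simp [hx]

theorem memLp_indicator_const_ball (R : ℝ) (c : R3) :
    MemLp ((Metric.ball (0 : R3) R).indicator fun _ => c) 2 volume :=
  memLp_indicator_const 2 measurableSet_ball c (Or.inr measure_ball_lt_top.ne)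

theorem isDemagField_const_ball {R : ℝ} (hR : 0 < R) (c : R3) :
    IsDemagField (Metric.ball 0 R) (fun _ => c) fun x => -ballField R c x := by
  refine ⟨(memLp_ballField hR c).neg, fun φ hφ hφ' => ?_, fun φ hφ hφ' i k => ?_⟩
  · simp_rw [← sub_eq_add_neg, inner_sub_left]
    have hi : ∀ v : R3 → R3, MemLp v 2 volume →
        Integrable fun x => inner ℝ (v x) (gradient φ x) := by
      intro v hv
      simp_rw [inner_gradient_eq]
      exact integrable_finsetSum _ fun i _ => integrable_coord_mul hv
        (contDiff_partialDeriv hφ i).continuous (hasCompactSupport_partialDeriv hφ' i) i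
    rw [integral_sub (hi _ (memLp_indicator_const_ball R c)) (hi _ (memLp_ballField hR c)),
      integral_inner_ballField_gradient hR c hφ hφ', sub_self]
  · simp only [PiLp.neg_apply, neg_mul, integral_neg]
    rw [weakCurlFree_ballField hR c φ hφ hφ' i k]

theorem setIntegral_inner_ballField {R : ℝ} (hR : 0 < R) (c : R3) {m : R3 → R3}
    (hm : IntegrableOn m (Metric.ball 0 R)) :
    ∫ x in Metric.ball 0 R, inner ℝ (-ballField R c x) (m x) =
      -(inner ℝ (∫ x in Metric.ball 0 R, m x) c) / 3 := by
  rw [setIntegral_congr_fun (g := fun x => (-(1 / 3) : ℝ) * inner ℝ c (m x)) measurableSet_ball]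
  · rw [integral_const_mul, integral_inner hm, real_inner_comm]
    ring
  · intro x hx
    simp only
    rw [ballField_of_lt hR c (by simpa using hx), inner_neg_left, real_inner_smul_left]
    ring

/-- A lower bound for the magnetostatic energy on a ball in terms of the mean magnetization. -/
theorem le_magnetostaticEnergy {R : ℝ} (hR : 0 < R) {m : R3 → R3}
    (hm : MemLp m 2 (volume.restrict (Metric.ball 0 R))) (c : R3) :
    (2 * inner ℝ (∫ x in Metric.ball 0 R, m x) c -
      volume.real (Metric.ball (0 : R3) R) * ‖c‖ ^ 2) / 3 ≤
      magnetostaticEnergy (Metric.ball 0 R) m := by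
  have hF : MemLp ((Metric.ball 0 R).indicator m) 2 volume :=
    (memLp_indicator_iff_restrict measurableSet_ball).2 hm
  have hFc := memLp_indicator_const_ball R c
  have hd := isDemagField_demagField hF
  have hdc := isDemagField_const_ball hR c
  obtain ⟨h1, h2⟩ := hd.mem_orthogonal hF
  obtain ⟨h3, h4⟩ := hdc.mem_orthogonal hFc
  -- With `F`, `Fc` the magnetizations and `H`, `Hc` their fields, these relations give `-⟨F,H⟩ =
  -- ‖H‖²`, `⟨H,Hc⟩ = -⟨F,Hc⟩` and `‖Hc‖² = -⟨Fc,Hc⟩`. The claim is then `‖H - Hc‖² ≥ 0` expanded.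
  have e1 := inner_eq_zero_of_mem_orthogonal h2 h1
  have e2 := inner_eq_zero_of_mem_orthogonal h2 h3
  have e3 := inner_eq_zero_of_mem_orthogonal h4 h3
  have i1 := setIntegral_inner_eq measurableSet_ball hF hd.memLp
  have i2 := setIntegral_inner_eq measurableSet_ball hF hdc.memLp
  have i3 := setIntegral_inner_eq measurableSet_ball hFc hdc.memLp
  have hfin : IsFiniteMeasure (volume.restrict (Metric.ball (0 : R3) R)) :=
    isFiniteMeasure_restrict.2 measure_ball_lt_top.ne
  rw [setIntegral_inner_ballField hR c (hm.integrable one_le_two)] at i2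
  rw [setIntegral_inner_ballField hR c (integrable_const c), setIntegral_const,
    real_inner_smul_left, real_inner_self_eq_norm_sq] at i3
  rw [magnetostaticEnergy, i1]
  set F := hF.toLp _
  set Fc := hFc.toLp _
  set H := hd.memLp.toLp _
  set Hc := hdc.memLp.toLp _
  have hn := real_inner_self_nonneg (x := H - Hc)
  simp only [inner_sub_left, inner_sub_right, inner_add_left] at e1 e2 e3 hn
  rw [real_inner_comm] at e1 e2 e3
  rw [real_inner_comm Hc H] at hn
  rw [real_inner_comm] at e1
  linarith [real_inner_comm H Hc, real_inner_comm F H, real_inner_comm F Hc,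
    real_inner_comm Fc Hc]

theorem magnetostaticEnergy_const {R : ℝ} (hR : 0 < R) (c : R3) :
    magnetostaticEnergy (Metric.ball 0 R) (fun _ => c) =
      volume.real (Metric.ball (0 : R3) R) * ‖c‖ ^ 2 / 3 := by
  have hFc := memLp_indicator_const_ball R c
  have hd := isDemagField_demagField hFc
  have hdc := isDemagField_const_ball hR c
  obtain ⟨h1, h2⟩ := hd.mem_orthogonal hFc
  obtain ⟨h3, h4⟩ := hdc.mem_orthogonal hFc
  -- Uniqueness identifies the chosen `demagField` with the explicit one.
  have e : hd.memLp.toLp _ = hdc.memLp.toLp _ := by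
    rw [← sub_eq_zero]
    refine eq_zero_of_mem_orthogonal ?_ (Submodule.sub_mem _ h1 h3)
    simpa using Submodule.sub_mem _ h2 h4
  have hfin : IsFiniteMeasure (volume.restrict (Metric.ball (0 : R3) R)) :=
    isFiniteMeasure_restrict.2 measure_ball_lt_top.ne
  rw [magnetostaticEnergy, setIntegral_inner_eq measurableSet_ball hFc hd.memLp, e,
    ← setIntegral_inner_eq measurableSet_ball hFc hdc.memLp,
    setIntegral_inner_ballField hR c (integrable_const c), setIntegral_const,
    real_inner_smul_left, real_inner_self_eq_norm_sq]
  ring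

/-! ### Exchange energy and mean magnetization -/

/-- The double integral of `‖m x - m y‖²` for a field `m` of unit length. -/
theorem lintegral_lintegral_norm_sub_sq {μ : Measure R3} [IsFiniteMeasure μ] {m : R3 → R3}
    (hm : Integrable m μ) (hunit : ∀ᵐ x ∂μ, ‖m x‖ = 1) :
    ∫⁻ x, ∫⁻ y, ENNReal.ofReal (‖m x - m y‖ ^ 2) ∂μ ∂μ =
      ENNReal.ofReal (2 * (μ.real Set.univ ^ 2 - ‖∫ x, m x ∂μ‖ ^ 2)) := by
  set V := μ.real Set.univ
  set M := ∫ x, m x ∂μ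
  have hMV : ‖M‖ ≤ V := by
    have := norm_integral_le_of_norm_le_const (hunit.mono fun x hx => hx.le)
    simpa using this
  have inner1 : ∀ᵐ x ∂μ, ∫⁻ y, ENNReal.ofReal (‖m x - m y‖ ^ 2) ∂μ =
      ENNReal.ofReal (2 * V - 2 * inner ℝ M (m x)) := by
    filter_upwards [hunit] with x hx
    have hi : Integrable (fun y => 2 - 2 * inner ℝ (m x) (m y)) μ :=
      (integrable_const _).sub ((hm.const_inner (m x)).const_mul 2)
    have hae : ∀ᵐ y ∂μ, ‖m x - m y‖ ^ 2 = 2 - 2 * inner ℝ (m x) (m y) := by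
      filter_upwards [hunit] with y hy
      rw [norm_sub_sq_real, hx, hy]
      ring
    have hnn : 0 ≤ᵐ[μ] fun y => 2 - 2 * inner ℝ (m x) (m y) := by
      filter_upwards [hae] with y hy
      rw [Pi.zero_apply, ← hy]
      positivity
    rw [lintegral_congr_ae (hae.mono fun y hy => by rw [hy]),
      ← ofReal_integral_eq_lintegral_ofReal hi hnn,
      integral_sub (integrable_const _) ((hm.const_inner (m x)).const_mul 2), integral_const_mul,
      integral_inner hm, real_inner_comm, integral_const, smul_eq_mul, mul_comm]
  rw [lintegral_congr_ae inner1]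
  have hi : Integrable (fun x => 2 * V - 2 * inner ℝ M (m x)) μ :=
    (integrable_const _).sub ((hm.const_inner M).const_mul 2)
  have hnn : 0 ≤ᵐ[μ] fun x => 2 * V - 2 * inner ℝ M (m x) := by
    filter_upwards [hunit] with x hx
    have := real_inner_le_norm M (m x)
    rw [hx, mul_one] at this
    simp only [Pi.zero_apply]
    linarith
  rw [← ofReal_integral_eq_lintegral_ofReal hi hnn,
    integral_sub (integrable_const _) ((hm.const_inner M).const_mul 2), integral_const_mul,
    integral_const_mul, integral_inner hm, real_inner_self_eq_norm_sq, integral_const, smul_eq_mul]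
  congr 1
  ring

/-- Equality case of the triangle inequality for integrals: the squared deviation from the mean
integrates to zero. -/
theorem ae_eq_average_of_norm_integral_eq {μ : Measure R3} [IsFiniteMeasure μ] {m : R3 → R3}
    (hm : Integrable m μ) (hunit : ∀ᵐ x ∂μ, ‖m x‖ = 1) (hV : 0 < μ.real Set.univ)
    (h : ‖∫ x, m x ∂μ‖ = μ.real Set.univ) :
    ∀ᵐ x ∂μ, m x = (μ.real Set.univ)⁻¹ • ∫ x, m x ∂μ := by
  set V := μ.real Set.univ
  set M := ∫ x, m x ∂μ
  have hae : ∀ᵐ x ∂μ, ‖m x - V⁻¹ • M‖ ^ 2 = 2 - 2 * V⁻¹ * inner ℝ M (m x) := by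
    filter_upwards [hunit] with x hx
    rw [norm_sub_sq_real, hx, norm_smul, h, real_inner_smul_right, norm_inv, Real.norm_eq_abs,
      abs_of_pos hV, inv_mul_cancel₀ hV.ne', real_inner_comm]
    ring
  have hi : Integrable (fun x => 2 - 2 * V⁻¹ * inner ℝ M (m x)) μ :=
    (integrable_const _).sub ((hm.const_inner M).const_mul _)
  have h0 : ∫ x, ‖m x - V⁻¹ • M‖ ^ 2 ∂μ = 0 := by
    rw [integral_congr_ae hae, integral_sub (integrable_const _) ((hm.const_inner M).const_mul _),
      integral_const_mul, integral_inner hm, real_inner_self_eq_norm_sq, integral_const,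
      smul_eq_mul, h]
    change V * 2 - 2 * V⁻¹ * V ^ 2 = 0
    field_simp
    ring
  rw [integral_eq_zero_iff_of_nonneg (fun x => by positivity)
    (hi.congr (hae.mono fun x hx => hx.symm))] at h0
  filter_upwards [h0] with x hx
  exact sub_eq_zero.1 (norm_eq_zero.1 (pow_eq_zero_iff two_ne_zero |>.1 hx))

theorem le_exchangeEnergy_ball {j : R3 → ℝ≥0∞} {R₀ C s R : ℝ} (hj : KernelLowerBound j R₀ C s)
    (hR : 2 * R < R₀) (m : R3 → R3) :
    ENNReal.ofReal (C / (2 * R) ^ (3 + 2 * s)) *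
      ∫⁻ x in Metric.ball 0 R, ∫⁻ y in Metric.ball 0 R, ENNReal.ofReal (‖m x - m y‖ ^ 2) ≤
      exchangeEnergy j (Metric.ball 0 R) m := by
  obtain ⟨-, hC, hs, -, hb⟩ := hj
  rw [exchangeEnergy, ← lintegral_const_mul' _ _ ENNReal.ofReal_ne_top]
  refine setLIntegral_mono' measurableSet_ball fun x hx => ?_
  rw [← lintegral_const_mul' _ _ ENNReal.ofReal_ne_top]
  refine setLIntegral_mono' measurableSet_ball fun y hy => ?_
  -- On the diagonal the difference of `m` vanishes, so the uncontrolled value `j 0` is harmless.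
  rcases eq_or_ne x y with rfl | hxy
  · simp
  · gcongr
    have hlt : ‖x - y‖ < 2 * R := by
      rw [mem_ball_zero_iff] at hx hy
      linarith [norm_sub_le x y]
    refine le_trans (ENNReal.ofReal_le_ofReal ?_) (hb _ (sub_ne_zero.2 hxy) (hlt.trans hR))
    have : 0 < ‖x - y‖ := norm_pos_iff.2 (sub_ne_zero.2 hxy)
    gcongr

theorem admissible_const (j : R3 → ℝ≥0∞) (R : ℝ) {c : R3} (hc : ‖c‖ = 1) :
    Admissible j (Metric.ball 0 R) fun _ => c where
  memLp := (memLp_indicator_iff_restrict measurableSet_ball).1 (memLp_indicator_const_ball R c)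
  unit := Eventually.of_forall fun _ => by simpa using hc
  finite := by simp [exchangeEnergy]

/-! ### Energy comparison and the critical radius -/

/-- On a ball whose volume is small compared with the strength of the exchange kernel, every
minimizer is constant. -/
theorem isConstantOn_of_isMinimizer {j : R3 → ℝ≥0∞} {R₀ C s R : ℝ}
    (hj : KernelLowerBound j R₀ C s) (hR : 0 < R) (hR₀ : 2 * R < R₀)
    (hsmall : 1 < 6 * (C / (2 * R) ^ (3 + 2 * s)) * volume.real (Metric.ball (0 : R3) R))
    {m : R3 → R3} (hm : IsMinimizer j (Metric.ball 0 R) m) :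
    IsConstantOn (Metric.ball 0 R) m := by
  obtain ⟨hadm, hmin⟩ := hm
  have hfin : IsFiniteMeasure (volume.restrict (Metric.ball (0 : R3) R)) :=
    isFiniteMeasure_restrict.2 measure_ball_lt_top.ne
  have hint := hadm.memLp.integrable one_le_two
  have hunit : ∀ᵐ x ∂volume.restrict (Metric.ball (0 : R3) R), ‖m x‖ = 1 :=
    hadm.unit.mono fun x hx => by simpa using hx
  have hσ : ‖(EuclideanSpace.single 0 1 : R3)‖ = 1 := by simp
  have hE := hmin _ (admissible_const j R hσ)
  have hJ := le_exchangeEnergy_ball hj hR₀ m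
  rw [lintegral_lintegral_norm_sub_sq hint hunit] at hJ
  have hVdef : (volume.restrict (Metric.ball (0 : R3) R)).real Set.univ =
      volume.real (Metric.ball (0 : R3) R) := by simp [measureReal_def]
  have hVpos : 0 < volume.real (Metric.ball (0 : R3) R) :=
    ENNReal.toReal_pos (Metric.measure_ball_pos _ _ hR).ne' measure_ball_lt_top.ne
  -- The mean is the choice of `c` that maximizes the lower bound, with value `|M|²/(3V)`.
  have hW := le_magnetostaticEnergy hR hadm.memLp ((volume.real (Metric.ball (0 : R3) R))⁻¹ •
    ∫ x in Metric.ball 0 R, m x)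
  have hMV : ‖∫ x in Metric.ball (0 : R3) R, m x‖ ≤ volume.real (Metric.ball (0 : R3) R) := by
    have := norm_integral_le_of_norm_le_const (hunit.mono fun x hx => hx.le)
    rwa [hVdef, one_mul] at this
  have hconst := ae_eq_average_of_norm_integral_eq hint hunit
  rw [hVdef] at hJ hconst
  have hC : 0 < C := hj.2.1
  set κ := C / (2 * R) ^ (3 + 2 * s)
  have hκ0 : 0 < κ := by positivity
  set V := volume.real (Metric.ball (0 : R3) R)
  set M := ∫ x in Metric.ball (0 : R3) R, m x
  rw [real_inner_smul_right, real_inner_self_eq_norm_sq, norm_smul, norm_inv, Real.norm_eq_abs,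
    abs_of_pos hVpos, show (2 * (V⁻¹ * ‖M‖ ^ 2) - V * (V⁻¹ * ‖M‖) ^ 2) / 3 =
      ‖M‖ ^ 2 / (3 * V) by field_simp; ring] at hW
  rw [← ENNReal.ofReal_mul hκ0.le] at hJ
  rw [energy, energy, magnetostaticEnergy_const hR, hσ,
    show exchangeEnergy j (Metric.ball 0 R) (fun _ => (EuclideanSpace.single 0 1 : R3)) = 0 by
      simp [exchangeEnergy], EReal.coe_ennreal_zero, zero_add] at hE
  have hEreal : κ * (2 * (V ^ 2 - ‖M‖ ^ 2)) + ‖M‖ ^ 2 / (3 * V) ≤ V * 1 ^ 2 / 3 := by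
    rw [← EReal.coe_le_coe_iff, EReal.coe_add]
    refine le_trans (add_le_add ?_ (EReal.coe_le_coe_iff.2 hW)) hE
    refine le_trans ?_ (EReal.coe_ennreal_le_coe_ennreal_iff.2 hJ)
    rw [EReal.coe_ennreal_ofReal]
    exact EReal.coe_le_coe_iff.2 (le_max_left _ _)
  refine ⟨_, hconst hVpos (le_antisymm hMV ?_)⟩
  by_contra hlt
  have hD : 0 < V ^ 2 - ‖M‖ ^ 2 := by nlinarith [norm_nonneg M, not_le.1 hlt]
  -- The comparison inequality multiplied by `3V`; with `6κV > 1` it contradicts `|M| < V`.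
  have h1 : 6 * κ * V * (V ^ 2 - ‖M‖ ^ 2) ≤ V ^ 2 - ‖M‖ ^ 2 := by
    have := mul_le_mul_of_nonneg_left hEreal (by positivity : 0 ≤ 3 * V)
    have e : 3 * V * (‖M‖ ^ 2 / (3 * V)) = ‖M‖ ^ 2 := by field_simp
    rw [mul_add, e] at this
    linarith
  nlinarith

/-- The powers `R^3` cancel and the left-over quantity is `πC/(2R)^(2s)`, which is at least `π` as
soon as `(2R)^(2s) ≤ C`. -/
theorem one_lt_of_radius_le {C s R : ℝ} (hC : 0 < C) (hs : 0 < s) (hR : 0 < R)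
    (h : R ≤ C ^ (1 / (2 * s)) / 2) :
    1 < 6 * (C / (2 * R) ^ (3 + 2 * s)) * volume.real (Metric.ball (0 : R3) R) := by
  have hV : volume.real (Metric.ball (0 : R3) R) = R ^ 3 * (Real.pi * 4 / 3) := by
    rw [measureReal_def, EuclideanSpace.volume_ball_fin_three, ENNReal.toReal_mul,
      ENNReal.toReal_pow, ENNReal.toReal_ofReal hR.le, ENNReal.toReal_ofReal (by positivity)]
  have hp : (2 * R) ^ (3 + 2 * s) = (2 * R) ^ 3 * (2 * R) ^ (2 * s) := by
    rw [Real.rpow_add (by positivity)]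
    norm_cast
  have hle : (2 * R) ^ (2 * s) ≤ C := by
    calc (2 * R) ^ (2 * s) ≤ (C ^ (1 / (2 * s))) ^ (2 * s) := by
          gcongr
          linarith
      _ = C := by
          rw [← Real.rpow_mul hC.le, one_div_mul_cancel (by positivity), Real.rpow_one]
  have hq : 0 < (2 * R) ^ (2 * s) := by positivity
  rw [hV, hp, show 6 * (C / ((2 * R) ^ 3 * (2 * R) ^ (2 * s))) * (R ^ 3 * (Real.pi * 4 / 3)) =
    Real.pi * C / (2 * R) ^ (2 * s) by field_simp; ring, one_lt_div hq]
  nlinarith [Real.pi_gt_three]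

end NonlocalMicromagnetics

theorem mainTheorem3
    (j : NonlocalMicromagnetics.R3 → ENNReal)
    (hmeas : Measurable j)
    (hJ1 : NonlocalMicromagnetics.KernelSymmetric j)
    (hJ2 : NonlocalMicromagnetics.KernelLevy j)
    (R₀ C s : ℝ)
    (hJ5 : NonlocalMicromagnetics.KernelLowerBound j R₀ C s) :
    ∃ Rcrit : ℝ, 0 < Rcrit ∧ Rcrit < R₀ / 2 ∧
      ∀ R : ℝ, 0 < R → R ≤ Rcrit →
        ∀ m : NonlocalMicromagnetics.R3 → NonlocalMicromagnetics.R3,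
          NonlocalMicromagnetics.IsMinimizer j (Metric.ball 0 R) m →
            NonlocalMicromagnetics.IsConstantOn (Metric.ball 0 R) m := by
  obtain ⟨hR₀, hC, hs, -, -⟩ := id hJ5
  -- `R₀ / 4` keeps the radius strictly below `R₀ / 2`, so differences of points stay in the range
  -- of the kernel bound; the other term solves `(2R)^(2s) = C`.
  refine ⟨min (R₀ / 4) (C ^ (1 / (2 * s)) / 2), by positivity,
    (min_le_left _ _).trans_lt (by linarith), fun R hR hle m hm => ?_⟩
  have h1 := hle.trans (min_le_left _ _)
  exact NonlocalMicromagnetics.isConstantOn_of_isMinimizer hJ5 hR (by linarith)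
    (NonlocalMicromagnetics.one_lt_of_radius_le hC hs hR (hle.trans (min_le_right _ _))) hm
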